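/- Let $\psi$ be the Laplace exponent of a spectrally negative Lévy process $X$ with non-monotone paths, i.e. $E(e^{\lambda X_t})=e^{t\psi(\lambda)}$ and $$\psi(\lambda)=-\mu\lambda+\frac{\sigma^2}{2}\lambda^2+\int_{(-\infty,0)}\bigl(e^{\lambda x}-1-\lambda x\mathbf 1_{|x|<1}\bigr)\,\Pi(dx),\qquad \lambda\ge 0,$$ where $\mu,\sigma\in\mathbb R$ and $\Pi$ is a measure on $(-\infty,0)$ with $\int(1\wedge x^2)\,\Pi(dx)<\infty$. Let $\psi'(0+)\in[-\infty,\infty)$ be its right derivative at $0$. For $q\ge 0$ put $\psi^{(q)}=\psi-q$ and let $\Phi(q)=\sup\{\lambda\ge0:\psi(\lambda)=q\}$ be the largest root of $\psi^{(q)}$ on $[0,\infty)$. Let $W^{(q)}$ be the $q$-scale function of $\psi$: it is nonnegative, vanishes on $(-\infty,0)$, is right continuous on $[0,\infty)$, and satisfies $\int_0^\infty e^{-\lambda x}W^{(q)}(x)\,dx=1/(\psi(\lambda)-q)$ for $\lambda>\Phi(q)$. For a Laplace exponent $f$ of the above class write $W_f$ for its scale function (the case $q=0$ of this definition). For $\delta,\beta\ge0$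 let $$\mathcal T_{\delta,\beta}\psi^{(q)}(u)=\frac{u+\beta-\delta}{u+\beta}\,\psi^{(q)}(u+\beta)-\frac{\beta-\delta}{\beta}\,\psi^{(q)}(\beta),\qquad u\ge0,$$ where for $\beta=0$ it is required that $\psi'(0+)=q=0$; in that case the expression is read by continuity at $u=0$, and its last term is $0$. (i) Let $q,\beta\ge0$, with $\psi'(0+)=q=0$ if $\beta=0$. Then $\mathcal T_{\beta,\beta}\psi^{(q)}$ is the Laplace exponent of a spectrally negative Lévy process with non-monotone paths (without killing), and it has exactly one scale function, given for $x\ge0$ by $$W_{\mathcal T_{\beta,\beta}\psi^{(q)}}(x)=e^{-\beta x}W^{(q)}(x)+\beta\int_0^xe^{-\beta y}W^{(q)}(y)\,dy .$$ (ii) Suppose that $\psi'(0+)\le0$. Then, for all $q,\delta\ge0$, $\mathcal T_{\delta,\Phi(q)}\psi^{(q)}$ is the Laplace exponent of a spectrally negative Lévy process with non-monotone paths (without killing), and it has exactly one scale function, given for $x\ge0$ by $$W_{\mathcal T_{\delta,\Phi(q)}\psi^{(q)}}(x)=e^{-\Phi(q)x}\Bigl(W^{(q)}(x)+\delta e^{\delta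 x}\int_0^xe^{-\delta y}W^{(q)}(y)\,dy\Bigr).$$ In particular, for $q=0$ this is the formula for $\mathcal T_{\delta,\Phi(0)}\psi$ in terms of $\Phi(0)$ and $W=W^{(0)}$. -/

import Mathlib

open MeasureTheory Set Filter Topology

/-- `(μ, σ, ν)` is the Lévy triplet of a spectrally negative Lévy process with non-monotone paths:
`ν` is a measure carried by `(-∞, 0)` that integrates `1 ∧ x²`.  Decreasing paths occur exactly when
`σ = 0`, `∫_{(-1,0)} |x| ν(dx) < ∞` and the drift `-μ - ∫_{(-1,0)} x ν(dx)` is at most `0`; increasing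
paths occur only for a pure linear drift (`σ = 0`, `ν = 0`).  Both are excluded. -/
structure IsSpectrallyNegativeTriplet (μ σ : ℝ) (ν : Measure ℝ) : Prop where
  carried : ν (Ici 0) = 0
  integrates : ∫⁻ x, ENNReal.ofReal (min 1 (x ^ 2)) ∂ν < ⊤
  not_monotone : σ ≠ 0 ∨ ¬ IntegrableOn (fun x : ℝ => x) (Ioo (-1) 0) ν ∨
    (ν ≠ 0 ∧ 0 < -μ - ∫ x in Ioo (-1 : ℝ) 0, x ∂ν)

/-- The Lévy–Khintchine formula for the Laplace exponent at `t ≥ 0`, that is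
`log E (exp (t X₁))` for the spectrally negative Lévy process `X` with triplet `(μ, σ, ν)`. -/
noncomputable def levyKhintchine (μ σ : ℝ) (ν : Measure ℝ) (t : ℝ) : ℝ :=
  -μ * t + σ ^ 2 / 2 * t ^ 2 +
    ∫ x, (Real.exp (t * x) - 1 - t * x * (Ioo (-1 : ℝ) 1).indicator 1 x) ∂ν

/-- `ψ`, on `[0, ∞)`, is the Laplace exponent of a spectrally negative Lévy process
(without killing, and with non-monotone paths). -/
def IsLaplaceExponent (ψ : ℝ → ℝ) : Prop :=
  ∃ (μ σ : ℝ) (ν : Measure ℝ), IsSpectrallyNegativeTriplet μ σ ν ∧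
    ∀ t : ℝ, 0 ≤ t → ψ t = levyKhintchine μ σ ν t

/-- `Φ(q)`, the largest root of `ψ = q` on `[0, ∞)`. -/
noncomputable def largestRoot (ψ : ℝ → ℝ) (q : ℝ) : ℝ :=
  sSup {t : ℝ | 0 ≤ t ∧ ψ t = q}

/-- `W` is the `q`-scale function attached to the exponent `ψ`: nonnegative, zero on `(-∞, 0)`,
right continuous on `[0, ∞)`, with Laplace transform `1 / (ψ - q)` on `(Φ(q), ∞)`. -/
structure IsScaleFunction (ψ : ℝ → ℝ) (q : ℝ) (W : ℝ → ℝ) : Prop where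
  nonneg : ∀ x, 0 ≤ W x
  eq_zero : ∀ x, x < 0 → W x = 0
  right_continuous : ∀ x, 0 ≤ x → ContinuousWithinAt W (Ici x) x
  integrable : ∀ t, largestRoot ψ q < t →
    IntegrableOn (fun x => Real.exp (-t * x) * W x) (Ioi 0)
  laplace : ∀ t, largestRoot ψ q < t →
    ∫ x in Ioi (0 : ℝ), Real.exp (-t * x) * W x = 1 / (ψ t - q)

/-- `ψ'(0+) = m`, where `m = -∞` is allowed. -/
def HasRightDerivAtZero (ψ : ℝ → ℝ) (m : EReal) : Prop :=
  Tendsto (fun t : ℝ => (((ψ t - ψ 0) / t : ℝ) : EReal)) (𝓝[>] 0) (𝓝 m)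

/-- The killed exponent `ψ^{(q)} = ψ - q`. -/
def killedExponent (ψ : ℝ → ℝ) (q : ℝ) : ℝ → ℝ := fun u => ψ u - q

/-- The transform `T_{δ,β} f`, for `u ≥ 0`.  It is applied with `β > 0`, or with `β = 0` to an `f`
with `f(0) = 0` and `f'(0+) = 0`; in the second case the terms `-δ f(u) / u` at `u = 0` and
`((β - δ) / β) f(β)` at `β = 0` are limits equal to `0`, the value that division by zero gives here. -/
noncomputable def expTransform (δ β : ℝ) (f : ℝ → ℝ) : ℝ → ℝ := fun u =>
  (u + β - δ) / (u + β) * f (u + β) - (β - δ) / β * f β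

/-!
Where no denominator vanishes, `T_{δ,β} f (u)` is the Esscher transform `f(u + β) - f(β)` minus `δ`
times the difference of slopes `f(u + β) / (u + β) - f(β) / β`.  For `f = ψ - q`, where `ψ` has
Lévy measure `ν`, integration by parts writes this difference of slopes as `σ² u / 2` minus the
integral of `exp (u z) - 1` against `exp (β z) (ν((-∞, z)) + q) dz` on `(-∞, 0)`.  Hence the
transform is again a Lévy–Khintchine exponent; the paths are non-monotone because it still tends
to `∞`.

When `(β - δ) / β * f(β) = 0` the transform is `(u + β - δ) / (u + β) * f(u + β)`.  Its reciprocal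
is the Laplace transform at `u + β` of `W` plus `δ` times the convolution of `W` with `exp (δ x)`,
and a right continuous function is determined by its Laplace transform.
-/

section Integration

variable {α ι : Type*} [MeasurableSpace α] {m : Measure α} {l : Filter ι} {f : ι → α → ℝ}
  {F lo hi : α → ℝ}

lemma ae_lt_of_measure_Ici_eq_zero [LinearOrder α] {a : α} (h : m (Ici a) = 0) :
    ∀ᵐ x ∂m, x < a := by
  simpa only [mem_Ici, not_le] using measure_eq_zero_iff_ae_notMem.1 h

-- Fatou's lemma for `f i - lo`.
lemma integrable_of_tendsto_of_integral_le [l.NeBot] [l.IsCountablyGenerated] {C : ℝ}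
    (hfm : ∀ i, AEStronglyMeasurable (f i) m) (hlo : Integrable lo m)
    (hf : ∀ᶠ i in l, Integrable (f i) m) (hlof : ∀ᶠ i in l, lo ≤ᵐ[m] f i)
    (hC : ∀ᶠ i in l, ∫ x, f i x ∂m ≤ C)
    (hF : ∀ᵐ x ∂m, Tendsto (fun i => f i x) l (𝓝 (F x))) : Integrable F m := by
  have hFm : AEStronglyMeasurable F m := aestronglyMeasurable_of_tendsto_ae l hfm hF
  suffices h : Integrable (F - lo) m by simpa only [sub_add_cancel] using h.add hlo
  refine ⟨hFm.sub hlo.1, ?_⟩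
  have hbound : ∀ᶠ i in l, ∫⁻ x, ‖f i x - lo x‖ₑ ∂m ≤ ENNReal.ofReal (C - ∫ x, lo x ∂m) := by
    filter_upwards [hf, hlof, hC] with i hfi hloi hCi
    have hnonneg : 0 ≤ᵐ[m] fun x => f i x - lo x := hloi.mono fun x hx => sub_nonneg.2 hx
    have hint : Integrable (fun x => f i x - lo x) m := hfi.sub hlo
    rw [lintegral_congr_ae (hnonneg.mono fun x hx => Real.enorm_of_nonneg hx),
      ← ofReal_integral_eq_lintegral_ofReal hint hnonneg, integral_sub hfi hlo]
    gcongr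
  calc ∫⁻ x, ‖(F - lo) x‖ₑ ∂m
      = ∫⁻ x, liminf (fun i => ‖f i x - lo x‖ₑ) l ∂m :=
        lintegral_congr_ae (hF.mono fun x hx => ((hx.sub_const (lo x)).enorm.liminf_eq).symm)
    _ ≤ liminf (fun i => ∫⁻ x, ‖f i x - lo x‖ₑ ∂m) l :=
        lintegral_liminf_le' fun i => ((hfm i).sub hlo.1).enorm
    _ ≤ ENNReal.ofReal (C - ∫ x, lo x ∂m) := (liminf_le_liminf hbound).trans_eq (liminf_const _)
    _ < ⊤ := ENNReal.ofReal_lt_top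

lemma tendsto_integral_of_mem_Icc [l.IsCountablyGenerated]
    (hfm : ∀ i, AEStronglyMeasurable (f i) m) (hlo : Integrable lo m) (hhi : Integrable hi m)
    (hf : ∀ᶠ i in l, ∀ᵐ x ∂m, f i x ∈ Icc (lo x) (hi x))
    (hF : ∀ᵐ x ∂m, Tendsto (fun i => f i x) l (𝓝 (F x))) :
    Tendsto (fun i => ∫ x, f i x ∂m) l (𝓝 (∫ x, F x ∂m)) := by
  refine tendsto_integral_filter_of_dominated_convergence (fun x => max |lo x| |hi x|)
    (Eventually.of_forall hfm) ?_ (hlo.abs.sup hhi.abs) hF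
  filter_upwards [hf] with i hfi
  filter_upwards [hfi] with x hx using abs_le_max_abs_abs hx.1 hx.2

end Integration

lemma min_one_sq_of_mem {x : ℝ} (hx : x ∈ Ioo (-1 : ℝ) 0) : min 1 (x ^ 2) = x ^ 2 :=
  min_eq_right (by nlinarith [hx.1, hx.2])

lemma min_one_sq_of_le {x : ℝ} (hx : x ≤ -1) : min 1 (x ^ 2) = 1 :=
  min_eq_left (by nlinarith)

lemma min_one_sq_le_min_one_abs (x : ℝ) : min 1 (x ^ 2) ≤ min 1 |x| := by
  rcases le_total 1 |x| with h | h
  · simpa only [min_eq_left h] using min_le_left _ _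
  · rw [min_eq_right h, ← sq_abs]
    exact (min_le_right _ _).trans (pow_le_of_le_one (abs_nonneg x) h two_ne_zero)

/-- The part `x 1_{|x| < 1}` of a jump `x` that the Lévy–Khintchine formula compensates. -/
noncomputable def smallJump : ℝ → ℝ := (Ioo (-1) 1).indicator id

lemma mul_indicator_one_eq_smallJump (x : ℝ) :
    x * (Ioo (-1 : ℝ) 1).indicator 1 x = smallJump x := by
  simp [smallJump, indicator_apply]

@[fun_prop]
lemma measurable_smallJump : Measurable smallJump :=
  measurable_id.indicator measurableSet_Ioo

lemma smallJump_of_mem {x : ℝ} (hx : x ∈ Ioo (-1 : ℝ) 0) : smallJump x = x :=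
  indicator_of_mem (Ioo_subset_Ioo_right zero_le_one hx) id

lemma smallJump_of_le {x : ℝ} (hx : x ≤ -1) : smallJump x = 0 :=
  indicator_of_notMem (fun h => h.1.not_ge hx) id

lemma abs_smallJump_le (x : ℝ) : |smallJump x| ≤ min 1 |x| := by
  by_cases h : x ∈ Ioo (-1 : ℝ) 1
  · simpa [smallJump, h] using (abs_lt.2 h).le
  · simp [smallJump, h]

lemma intervalIntegrable_exp_mul (t a b : ℝ) :
    IntervalIntegrable (fun z : ℝ => Real.exp (t * z)) volume a b :=
  Continuous.intervalIntegrable (by fun_prop) a b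

lemma exp_mul_le_one {t x : ℝ} (ht : 0 ≤ t) (hx : x ≤ 0) : Real.exp (t * x) ≤ 1 :=
  Real.exp_le_one_iff.2 (mul_nonpos_of_nonneg_of_nonpos ht hx)

lemma abs_exp_mul_sub_one_le {t x : ℝ} (ht : 0 ≤ t) (hx : x ≤ 0) :
    |Real.exp (t * x) - 1| ≤ (t + 1) * min 1 |x| := by
  have hexp := exp_mul_le_one ht hx
  have hpos := Real.exp_pos (t * x)
  have hlin := Real.add_one_le_exp (t * x)
  rw [abs_of_nonpos (by linarith), abs_of_nonpos hx]
  rcases min_cases 1 (-x) with ⟨h, _⟩ | ⟨h, _⟩ <;> rw [h] <;> nlinarith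

/-- The integral of `z ↦ exp (t z)` over `[x, 0]`, equal to `(1 - exp (t x)) / t` if `t ≠ 0` and to
`-x` if `t = 0`. -/
noncomputable def expPrimitive (t x : ℝ) : ℝ := ∫ z in x..0, Real.exp (t * z)

lemma mul_expPrimitive (t x : ℝ) : t * expPrimitive t x = 1 - Real.exp (t * x) := by
  rw [expPrimitive, intervalIntegral.mul_integral_comp_mul_left, integral_exp, mul_zero,
    Real.exp_zero]

lemma expPrimitive_eq_div {t : ℝ} (ht : t ≠ 0) (x : ℝ) :
    expPrimitive t x = (1 - Real.exp (t * x)) / t := by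
  rw [← mul_expPrimitive, mul_div_cancel_left₀ _ ht]

lemma expPrimitive_zero_left (x : ℝ) : expPrimitive 0 x = -x := by
  simp [expPrimitive]

lemma expPrimitive_nonneg (t : ℝ) {x : ℝ} (hx : x ≤ 0) : 0 ≤ expPrimitive t x :=
  intervalIntegral.integral_nonneg hx fun _ _ => (Real.exp_pos _).le

lemma expPrimitive_anti {x : ℝ} (hx : x ≤ 0) {s t : ℝ} (hst : s ≤ t) :
    expPrimitive t x ≤ expPrimitive s x :=
  intervalIntegral.integral_mono_on hx (intervalIntegrable_exp_mul _ _ _)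
    (intervalIntegrable_exp_mul _ _ _)
    fun _ hz => Real.exp_le_exp.2 (mul_le_mul_of_nonpos_right hst hz.2)

lemma expPrimitive_le_neg {t x : ℝ} (ht : 0 ≤ t) (hx : x ≤ 0) : expPrimitive t x ≤ -x :=
  (expPrimitive_anti hx ht).trans_eq (expPrimitive_zero_left x)

lemma expPrimitive_le_inv {t : ℝ} (ht : 0 < t) (x : ℝ) : expPrimitive t x ≤ t⁻¹ := by
  rw [expPrimitive_eq_div ht.ne', ← one_div]
  gcongr
  linarith [Real.exp_pos (t * x)]

lemma neg_sub_le_expPrimitive (t : ℝ) {x : ℝ} (hx : x ≤ 0) :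
    -x - t * x ^ 2 / 2 ≤ expPrimitive t x :=
  calc -x - t * x ^ 2 / 2 = ∫ z in x..0, (1 + t * z) := by
        rw [intervalIntegral.integral_add (by simp)
          (Continuous.intervalIntegrable (by fun_prop) _ _),
          intervalIntegral.integral_const_mul, integral_id, intervalIntegral.integral_const,
          smul_eq_mul]
        ring
    _ ≤ expPrimitive t x :=
        intervalIntegral.integral_mono_on hx (Continuous.intervalIntegrable (by fun_prop) _ _)
          (intervalIntegrable_exp_mul _ _ _) fun z _ => by linarith [Real.add_one_le_exp (t * z)]

lemma measurable_expPrimitive (t : ℝ) : Measurable (expPrimitive t) := by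
  rcases eq_or_ne t 0 with rfl | ht
  · simp only [funext expPrimitive_zero_left]
    fun_prop
  · simp only [funext (expPrimitive_eq_div ht)]
    fun_prop

lemma continuous_expPrimitive_left (x : ℝ) : Continuous fun t => expPrimitive t x :=
  intervalIntegral.continuous_parametric_intervalIntegral_of_continuous'
    (f := fun t z => Real.exp (t * z)) (by fun_prop) x 0

lemma tendsto_expPrimitive_atTop {x : ℝ} (hx : x ≤ 0) :
    Tendsto (fun t => expPrimitive t x) atTop (𝓝 0) := by
  refine squeeze_zero' (Eventually.of_forall fun t => expPrimitive_nonneg t hx) ?_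
    tendsto_inv_atTop_zero
  filter_upwards [eventually_gt_atTop 0] with t ht using expPrimitive_le_inv ht x

/-- The primitive `expPrimitive` with the compensator of small jumps added, so that `-t` times it is
the Lévy–Khintchine integrand. -/
noncomputable def compensatedPrimitive (t x : ℝ) : ℝ := expPrimitive t x + smallJump x

lemma levyIntegrand_eq (t x : ℝ) :
    Real.exp (t * x) - 1 - t * x * (Ioo (-1 : ℝ) 1).indicator 1 x =
      -(t * compensatedPrimitive t x) := by
  rw [compensatedPrimitive, ← mul_indicator_one_eq_smallJump]
  linear_combination mul_expPrimitive t x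

lemma measurable_compensatedPrimitive (t : ℝ) : Measurable (compensatedPrimitive t) :=
  (measurable_expPrimitive t).add measurable_smallJump

lemma aestronglyMeasurable_compensatedPrimitive (t : ℝ) (ν : Measure ℝ) :
    AEStronglyMeasurable (compensatedPrimitive t) ν :=
  (measurable_compensatedPrimitive t).aestronglyMeasurable

lemma continuous_compensatedPrimitive_left (x : ℝ) :
    Continuous fun t => compensatedPrimitive t x :=
  (continuous_expPrimitive_left x).add continuous_const

lemma tendsto_compensatedPrimitive_atTop {x : ℝ} (hx : x ≤ 0) :
    Tendsto (fun t => compensatedPrimitive t x) atTop (𝓝 (smallJump x)) := by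
  simpa only [compensatedPrimitive, zero_add] using
    (tendsto_expPrimitive_atTop hx).add_const (smallJump x)

lemma smallJump_le_compensatedPrimitive (t : ℝ) {x : ℝ} (hx : x ≤ 0) :
    smallJump x ≤ compensatedPrimitive t x :=
  le_add_of_nonneg_left (expPrimitive_nonneg t hx)

lemma compensatedPrimitive_anti {x : ℝ} (hx : x ≤ 0) {s t : ℝ} (hst : s ≤ t) :
    compensatedPrimitive t x ≤ compensatedPrimitive s x :=
  add_le_add_left (expPrimitive_anti hx hst) _

lemma compensatedPrimitive_of_le {x : ℝ} (hx : x ≤ -1) (t : ℝ) :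
    compensatedPrimitive t x = expPrimitive t x := by
  rw [compensatedPrimitive, smallJump_of_le hx, add_zero]

lemma abs_compensatedPrimitive_le_of_mem {x : ℝ} (hx : x ∈ Ioo (-1 : ℝ) 0) {t : ℝ}
    (ht : 0 ≤ t) : |compensatedPrimitive t x| ≤ t / 2 * min 1 (x ^ 2) := by
  have hupper := expPrimitive_le_neg ht hx.2.le
  have hlower := neg_sub_le_expPrimitive t hx.2.le
  have : 0 ≤ t / 2 * x ^ 2 := by positivity
  rw [compensatedPrimitive, smallJump_of_mem hx, min_one_sq_of_mem hx, abs_le]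
  constructor <;> linarith

lemma abs_compensatedPrimitive_le {x : ℝ} (hx : x < 0) {t : ℝ} (ht : 0 < t) :
    |compensatedPrimitive t x| ≤ (t / 2 + t⁻¹) * min 1 (x ^ 2) := by
  rcases lt_or_ge (-1) x with h | h
  · refine (abs_compensatedPrimitive_le_of_mem ⟨h, hx⟩ ht.le).trans ?_
    gcongr
    exact le_add_of_nonneg_right (by positivity)
  · rw [compensatedPrimitive_of_le h, min_one_sq_of_le h, mul_one,
      abs_of_nonneg (expPrimitive_nonneg t hx.le)]
    exact (expPrimitive_le_inv ht x).trans (le_add_of_nonneg_left (by positivity))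

lemma abs_mul_compensatedPrimitive_le {x : ℝ} (hx : x < 0) {t : ℝ} (ht : 0 ≤ t) :
    |t * compensatedPrimitive t x| ≤ (t ^ 2 / 2 + 1) * min 1 (x ^ 2) := by
  rcases ht.eq_or_lt with rfl | ht
  · simp only [zero_mul, abs_zero]
    positivity
  · rw [abs_mul, abs_of_pos ht]
    calc t * |compensatedPrimitive t x| ≤ t * ((t / 2 + t⁻¹) * min 1 (x ^ 2)) := by
          gcongr
          exact abs_compensatedPrimitive_le hx ht
      _ = (t ^ 2 / 2 + 1) * min 1 (x ^ 2) := by field_simp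

/-- The slope `ψ(t) / t` of the Lévy–Khintchine exponent `ψ` with triplet `(μ, σ, ν)`.  At `t = 0`
it is the right derivative of `ψ`, provided that `compensatedPrimitive 0` is integrable. -/
noncomputable def levySlope (μ σ : ℝ) (ν : Measure ℝ) (t : ℝ) : ℝ :=
  -μ + σ ^ 2 / 2 * t - ∫ x, compensatedPrimitive t x ∂ν

lemma levyKhintchine_eq (μ σ : ℝ) (ν : Measure ℝ) (t : ℝ) :
    levyKhintchine μ σ ν t =
      -μ * t + σ ^ 2 / 2 * t ^ 2 - ∫ x, t * compensatedPrimitive t x ∂ν := by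
  simp only [levyKhintchine, levyIntegrand_eq, integral_neg, ← sub_eq_add_neg]

lemma levyKhintchine_eq_mul_levySlope (μ σ : ℝ) (ν : Measure ℝ) (t : ℝ) :
    levyKhintchine μ σ ν t = t * levySlope μ σ ν t := by
  rw [levyKhintchine_eq, levySlope, integral_const_mul]
  ring

lemma levyKhintchine_zero (μ σ : ℝ) (ν : Measure ℝ) : levyKhintchine μ σ ν 0 = 0 := by
  rw [levyKhintchine_eq_mul_levySlope, zero_mul]

/-- A Lévy measure carried by `(-∞, 0)`. -/
structure IsNegLevyMeasure (ν : Measure ℝ) : Prop where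
  carried : ν (Ici 0) = 0
  integrates : ∫⁻ x, ENNReal.ofReal (min 1 (x ^ 2)) ∂ν < ⊤

lemma IsSpectrallyNegativeTriplet.isNegLevyMeasure {μ σ : ℝ} {ν : Measure ℝ}
    (h : IsSpectrallyNegativeTriplet μ σ ν) : IsNegLevyMeasure ν :=
  ⟨h.carried, h.integrates⟩

lemma IsSpectrallyNegativeTriplet.ne_zero_or_ne_zero {μ σ : ℝ} {ν : Measure ℝ}
    (h : IsSpectrallyNegativeTriplet μ σ ν) : σ ≠ 0 ∨ ν ≠ 0 := by
  refine h.not_monotone.imp_right (Or.rec ?_ And.left)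
  rintro hnot rfl
  exact hnot (by simp [IntegrableOn])

namespace IsNegLevyMeasure

variable {ν : Measure ℝ} (hν : IsNegLevyMeasure ν)
include hν

lemma ae_neg : ∀ᵐ x ∂ν, x < 0 := ae_lt_of_measure_Ici_eq_zero hν.carried

lemma integrable_min_one_sq : Integrable (fun x : ℝ => min 1 (x ^ 2)) ν := by
  refine ⟨by fun_prop, ?_⟩
  rw [hasFiniteIntegral_iff_ofReal (ae_of_all _ fun x => by positivity)]
  exact hν.integrates

lemma sFinite : SFinite ν := by
  have := isFiniteMeasure_withDensity hν.integrates.ne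
  refine sFinite_of_absolutelyContinuous (withDensity_absolutelyContinuous'
    (f := fun x => ENNReal.ofReal (min 1 (x ^ 2))) (by fun_prop) ?_)
  filter_upwards [hν.ae_neg] with x hx
  simpa using hx.ne

lemma integrable_of_abs_le {f : ℝ → ℝ} (hf : AEStronglyMeasurable f ν) (C : ℝ)
    (h : ∀ x < 0, |f x| ≤ C * min 1 (x ^ 2)) : Integrable f ν :=
  (hν.integrable_min_one_sq.const_mul C).mono' hf (hν.ae_neg.mono h)

lemma integrable_compensatedPrimitive {t : ℝ} (ht : 0 < t) :
    Integrable (compensatedPrimitive t) ν :=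
  hν.integrable_of_abs_le (aestronglyMeasurable_compensatedPrimitive t ν) _
    fun _ hx => abs_compensatedPrimitive_le hx ht

lemma integrable_mul_compensatedPrimitive {t : ℝ} (ht : 0 ≤ t) :
    Integrable (fun x => t * compensatedPrimitive t x) ν :=
  hν.integrable_of_abs_le ((measurable_compensatedPrimitive t).const_mul t).aestronglyMeasurable _
    fun _ hx => abs_mul_compensatedPrimitive_le hx ht

lemma ae_compensatedPrimitive_anti {s t : ℝ} (hst : s ≤ t) :
    compensatedPrimitive t ≤ᵐ[ν] compensatedPrimitive s :=
  hν.ae_neg.mono fun _ hx => compensatedPrimitive_anti hx.le hst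

lemma integral_compensatedPrimitive_anti {s t : ℝ} (hs : 0 < s) (hst : s ≤ t) :
    ∫ x, compensatedPrimitive t x ∂ν ≤ ∫ x, compensatedPrimitive s x ∂ν :=
  integral_mono_ae (hν.integrable_compensatedPrimitive (hs.trans_le hst))
    (hν.integrable_compensatedPrimitive hs) (hν.ae_compensatedPrimitive_anti hst)

lemma levySlope_mono (μ σ : ℝ) {s t : ℝ} (hs : 0 < s) (hst : s ≤ t) :
    levySlope μ σ ν s ≤ levySlope μ σ ν t := by
  unfold levySlope
  refine sub_le_sub (by gcongr) ?_
  exact hν.integral_compensatedPrimitive_anti hs hst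

lemma continuousOn_levyKhintchine (μ σ : ℝ) :
    ContinuousOn (levyKhintchine μ σ ν) (Ici 0) := by
  rw [funext (levyKhintchine_eq μ σ ν)]
  refine ContinuousOn.sub (by fun_prop) fun t₀ _ => ?_
  refine continuousWithinAt_of_dominated
    (bound := fun x => ((t₀ + 1) ^ 2 / 2 + 1) * min 1 (x ^ 2)) ?_ ?_
    (hν.integrable_min_one_sq.const_mul _) ?_
  · exact Eventually.of_forall fun t =>
      ((measurable_compensatedPrimitive t).const_mul t).aestronglyMeasurable
  · filter_upwards [self_mem_nhdsWithin,
      mem_nhdsWithin_of_mem_nhds (Iic_mem_nhds (lt_add_one t₀))] with t ht htt₀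
    filter_upwards [hν.ae_neg] with x hx
    refine (abs_mul_compensatedPrimitive_le hx ht).trans ?_
    have : t ^ 2 ≤ (t₀ + 1) ^ 2 := pow_le_pow_left₀ ht htt₀ 2
    gcongr
  · exact ae_of_all _ fun x =>
      (continuous_id.mul (continuous_compensatedPrimitive_left x)).continuousWithinAt

lemma restrict_Ioo_neg_one_one : ν.restrict (Ioo (-1) 1) = ν.restrict (Ioo (-1) 0) := by
  refine Measure.restrict_congr_set ?_
  filter_upwards [hν.ae_neg] with x hx
  exact propext (and_congr_right fun _ => iff_of_true (hx.trans one_pos) hx)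

lemma integrable_smallJump_iff :
    Integrable smallJump ν ↔ IntegrableOn (fun x : ℝ => x) (Ioo (-1) 0) ν := by
  rw [smallJump, integrable_indicator_iff measurableSet_Ioo, IntegrableOn,
    hν.restrict_Ioo_neg_one_one]
  rfl

lemma integral_smallJump : ∫ x, smallJump x ∂ν = ∫ x in Ioo (-1 : ℝ) 0, x ∂ν := by
  rw [smallJump, integral_indicator measurableSet_Ioo, hν.restrict_Ioo_neg_one_one]
  rfl

lemma tendsto_levySlope_atTop (μ : ℝ) (hint : Integrable smallJump ν) :
    Tendsto (levySlope μ 0 ν) atTop (𝓝 (-μ - ∫ x, smallJump x ∂ν)) := by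
  have hlim : Tendsto (fun t => ∫ x, compensatedPrimitive t x ∂ν) atTop
      (𝓝 (∫ x, smallJump x ∂ν)) := by
    refine tendsto_integral_of_mem_Icc (aestronglyMeasurable_compensatedPrimitive · ν) hint
      (hν.integrable_compensatedPrimitive one_pos) ?_
      (hν.ae_neg.mono fun x hx => tendsto_compensatedPrimitive_atTop hx.le)
    filter_upwards [eventually_ge_atTop 1] with t ht
    filter_upwards [hν.ae_neg] with x hx
    exact ⟨smallJump_le_compensatedPrimitive t hx.le, compensatedPrimitive_anti hx.le ht⟩
  exact (hlim.const_sub (-μ)).congr fun t => by simp [levySlope]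

lemma eq_zero_of_levySlope_le {μ σ C : ℝ} (h : ∀ t, 1 ≤ t → levySlope μ σ ν t ≤ C) : σ = 0 := by
  by_contra hσ
  have hquad : Tendsto (fun t : ℝ => σ ^ 2 / 2 * t) atTop atTop :=
    tendsto_id.const_mul_atTop (by positivity)
  obtain ⟨t, ht, hgt⟩ := ((eventually_ge_atTop 1).and (hquad.eventually_gt_atTop
    (C + μ + ∫ x, compensatedPrimitive 1 x ∂ν))).exists
  have hle := h t ht
  have hanti := hν.integral_compensatedPrimitive_anti one_pos ht
  unfold levySlope at hle
  linarith

lemma integrable_smallJump_of_levySlope_le {μ σ C : ℝ}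
    (h : ∀ t, 1 ≤ t → levySlope μ σ ν t ≤ C) : Integrable smallJump ν := by
  rw [← integrable_neg_iff]
  refine integrable_of_tendsto_of_integral_le (l := atTop) (C := C + μ)
    (f := fun t x => -compensatedPrimitive t x)
    (fun t => (aestronglyMeasurable_compensatedPrimitive t ν).neg)
    (hν.integrable_compensatedPrimitive one_pos).neg ?_ ?_ ?_
    (hν.ae_neg.mono fun x hx => (tendsto_compensatedPrimitive_atTop hx.le).neg)
  · filter_upwards [eventually_gt_atTop 0] with t ht
    exact (hν.integrable_compensatedPrimitive ht).neg
  · filter_upwards [eventually_ge_atTop 1] with t ht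
    exact (hν.ae_compensatedPrimitive_anti ht).mono fun x hx => neg_le_neg hx
  · filter_upwards [eventually_ge_atTop 1] with t ht
    have hslope := h t ht
    have hquad : 0 ≤ σ ^ 2 / 2 * t := by positivity
    unfold levySlope at hslope
    rw [integral_neg]
    linarith

lemma integrable_compensatedPrimitive_zero {μ σ m : ℝ}
    (h : Tendsto (levySlope μ σ ν) (𝓝[>] 0) (𝓝 m)) : Integrable (compensatedPrimitive 0) ν := by
  refine integrable_of_tendsto_of_integral_le (l := 𝓝[>] 0) (C := -μ + σ ^ 2 / 2 * 1 - m)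
    (aestronglyMeasurable_compensatedPrimitive · ν)
    (hν.integrable_compensatedPrimitive one_pos) ?_ ?_ ?_ (ae_of_all _ fun x =>
      ((continuous_compensatedPrimitive_left x).tendsto 0).mono_left nhdsWithin_le_nhds)
  · filter_upwards [self_mem_nhdsWithin] with t ht using hν.integrable_compensatedPrimitive ht
  · filter_upwards [Ioo_mem_nhdsGT one_pos] with t ht
    exact hν.ae_compensatedPrimitive_anti ht.2.le
  · filter_upwards [Ioo_mem_nhdsGT one_pos] with t ht
    have hslope : m ≤ levySlope μ σ ν t := le_of_tendsto h <| by
      filter_upwards [Ioo_mem_nhdsGT ht.1] with s hs using hν.levySlope_mono μ σ hs.1 hs.2.le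
    have hquad : σ ^ 2 / 2 * t ≤ σ ^ 2 / 2 * 1 := by
      gcongr
      exact ht.2.le
    unfold levySlope at hslope
    linarith

lemma tendsto_levySlope_zero (μ σ : ℝ) (hint : Integrable (compensatedPrimitive 0) ν) :
    Tendsto (levySlope μ σ ν) (𝓝[>] 0) (𝓝 (levySlope μ σ ν 0)) := by
  refine Tendsto.sub (Continuous.tendsto (by fun_prop) 0 |>.mono_left nhdsWithin_le_nhds)
    (tendsto_integral_of_mem_Icc (aestronglyMeasurable_compensatedPrimitive · ν)
      (hν.integrable_compensatedPrimitive one_pos) hint ?_ (ae_of_all _ fun x =>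
        ((continuous_compensatedPrimitive_left x).tendsto 0).mono_left nhdsWithin_le_nhds))
  filter_upwards [Ioo_mem_nhdsGT one_pos] with t ht
  filter_upwards [hν.ae_neg] with x hx
  exact ⟨compensatedPrimitive_anti hx.le ht.2.le, compensatedPrimitive_anti hx.le ht.1.le⟩

-- Monotone paths correspond to slopes with a nonpositive limit, hence to a nonpositive exponent.
lemma isSpectrallyNegativeTriplet_of_tendsto {μ σ : ℝ} (hne : σ ≠ 0 ∨ ν ≠ 0)
    (h : Tendsto (levyKhintchine μ σ ν) atTop atTop) : IsSpectrallyNegativeTriplet μ σ ν := by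
  refine ⟨hν.carried, hν.integrates, ?_⟩
  by_contra! hmon
  obtain ⟨rfl, hint, hdrift⟩ := hmon
  rw [← hν.integral_smallJump] at hdrift
  obtain ⟨t, ht0, ht⟩ := ((eventually_gt_atTop 0).and (h.eventually_gt_atTop 0)).exists
  have hslope : levySlope μ 0 ν t ≤ -μ - ∫ x, smallJump x ∂ν := by
    refine ge_of_tendsto (hν.tendsto_levySlope_atTop μ (hν.integrable_smallJump_iff.2 hint)) ?_
    filter_upwards [eventually_ge_atTop t] with s hs using hν.levySlope_mono μ 0 ht0 hs
  rw [levyKhintchine_eq_mul_levySlope] at ht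
  exact ht.not_ge (mul_nonpos_of_nonneg_of_nonpos ht0.le
    (hslope.trans (hdrift (hne.resolve_left (not_not.2 rfl)))))

end IsNegLevyMeasure

lemma IsSpectrallyNegativeTriplet.exists_levySlope_pos {μ σ : ℝ} {ν : Measure ℝ}
    (h : IsSpectrallyNegativeTriplet μ σ ν) : ∃ t, 1 ≤ t ∧ 0 < levySlope μ σ ν t := by
  have hν := h.isNegLevyMeasure
  by_contra! hle
  obtain rfl := hν.eq_zero_of_levySlope_le hle
  have hint := hν.integrable_smallJump_of_levySlope_le hle
  have hdrift : -μ - ∫ x in Ioo (-1 : ℝ) 0, x ∂ν ≤ 0 := by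
    rw [← hν.integral_smallJump]
    exact le_of_tendsto (hν.tendsto_levySlope_atTop μ hint)
      ((eventually_ge_atTop 1).mono hle)
  rcases h.not_monotone with hσ | hvar | ⟨-, hpos⟩
  exacts [hσ rfl, hvar (hν.integrable_smallJump_iff.1 hint), hpos.not_ge hdrift]

lemma IsSpectrallyNegativeTriplet.tendsto_atTop {μ σ : ℝ} {ν : Measure ℝ}
    (h : IsSpectrallyNegativeTriplet μ σ ν) : Tendsto (levyKhintchine μ σ ν) atTop atTop := by
  obtain ⟨t, ht, hpos⟩ := h.exists_levySlope_pos
  refine tendsto_atTop_mono' atTop ?_ (tendsto_id.atTop_mul_const hpos)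
  filter_upwards [eventually_ge_atTop t] with s hs
  rw [levyKhintchine_eq_mul_levySlope]
  exact mul_le_mul_of_nonneg_left (h.isNegLevyMeasure.levySlope_mono μ σ (by linarith) hs)
    (by simp only [id]; linarith)

namespace IsLaplaceExponent

variable {ψ : ℝ → ℝ} (hψ : IsLaplaceExponent ψ)
include hψ

lemma map_zero : ψ 0 = 0 := by
  obtain ⟨μ, σ, ν, -, hrep⟩ := hψ
  rw [hrep 0 le_rfl, levyKhintchine_zero]

lemma tendsto_atTop : Tendsto ψ atTop atTop := by
  obtain ⟨μ, σ, ν, hT, hrep⟩ := hψ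
  refine hT.tendsto_atTop.congr' ?_
  filter_upwards [eventually_ge_atTop 0] with t ht using (hrep t ht).symm

lemma continuousOn : ContinuousOn ψ (Ici 0) := by
  obtain ⟨μ, σ, ν, hT, hrep⟩ := hψ
  exact (hT.isNegLevyMeasure.continuousOn_levyKhintchine μ σ).congr hrep

lemma bddAbove_roots (q : ℝ) : BddAbove {t : ℝ | 0 ≤ t ∧ ψ t = q} := by
  obtain ⟨M, hM⟩ := eventually_atTop.1 (hψ.tendsto_atTop.eventually_gt_atTop q)
  exact ⟨M, fun t ht => le_of_not_ge fun hMt => (hM t hMt).ne' ht.2⟩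

lemma le_largestRoot {q t : ℝ} (ht : 0 ≤ t) (hroot : ψ t = q) : t ≤ largestRoot ψ q :=
  le_csSup (hψ.bddAbove_roots q) ⟨ht, hroot⟩

lemma exists_root {s q : ℝ} (hs : 0 ≤ s) (hle : ψ s ≤ q) : ∃ t, s ≤ t ∧ ψ t = q := by
  obtain ⟨M, hqM, hsM⟩ := ((hψ.tendsto_atTop.eventually_ge_atTop q).and
    (eventually_ge_atTop s)).exists
  obtain ⟨t, ht, hroot⟩ := intermediate_value_Icc hsM
    (hψ.continuousOn.mono fun x hx => hs.trans hx.1) ⟨hle, hqM⟩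
  exact ⟨t, ht.1, hroot⟩

lemma largestRoot_mem {q : ℝ} (hq : 0 ≤ q) :
    0 ≤ largestRoot ψ q ∧ ψ (largestRoot ψ q) = q :=
  IsClosed.csSup_mem
    (hψ.continuousOn.preimage_isClosed_of_isClosed isClosed_Ici (isClosed_singleton (x := q)))
    (hψ.exists_root le_rfl (hψ.map_zero.trans_le hq)) (hψ.bddAbove_roots q)

lemma nonneg_of_largestRoot_eq_zero (h0 : largestRoot ψ 0 = 0) {t : ℝ} (ht : 0 ≤ t) :
    0 ≤ ψ t := by
  by_contra! hneg
  obtain ⟨s, hts, hroot⟩ := hψ.exists_root ht hneg.le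
  have hs : s ≤ 0 := h0 ▸ hψ.le_largestRoot (ht.trans hts) hroot
  obtain rfl : t = 0 := le_antisymm (hts.trans hs) ht
  exact hneg.ne hψ.map_zero

lemma hasRightDerivAtZero_zero_of_nonpos {m : EReal} (hm : HasRightDerivAtZero ψ m) (hm0 : m ≤ 0)
    (h0 : largestRoot ψ 0 = 0) : HasRightDerivAtZero ψ 0 := by
  have hnonneg : 0 ≤ m := by
    refine ge_of_tendsto hm ?_
    filter_upwards [self_mem_nhdsWithin] with t ht
    rw [hψ.map_zero, sub_zero]
    exact EReal.coe_nonneg.2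
      (div_nonneg (hψ.nonneg_of_largestRoot_eq_zero h0 (le_of_lt ht)) (le_of_lt ht))
  rwa [le_antisymm hm0 hnonneg] at hm

end IsLaplaceExponent

lemma IsNegLevyMeasure.levySlope_zero_of_hasRightDerivAtZero {ψ : ℝ → ℝ} {μ σ m : ℝ}
    {ν : Measure ℝ} (hν : IsNegLevyMeasure ν) (hrep : ∀ t, 0 ≤ t → ψ t = levyKhintchine μ σ ν t)
    (h : HasRightDerivAtZero ψ m) :
    Integrable (compensatedPrimitive 0) ν ∧ levySlope μ σ ν 0 = m := by
  have hlim : Tendsto (levySlope μ σ ν) (𝓝[>] 0) (𝓝 m) := by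
    refine (EReal.tendsto_coe.1 h).congr' ?_
    filter_upwards [self_mem_nhdsWithin] with t ht
    rw [hrep t (le_of_lt ht), hrep 0 le_rfl, levyKhintchine_zero, sub_zero,
      levyKhintchine_eq_mul_levySlope, mul_div_cancel_left₀ _ (ne_of_gt ht)]
  have hint := hν.integrable_compensatedPrimitive_zero hlim
  exact ⟨hint, tendsto_nhds_unique (hν.tendsto_levySlope_zero μ σ hint) hlim⟩

/-- The exponential tilt `exp (β z) m(dz)`: the Lévy measure of an Esscher transform is the tilt of
the original one. -/
noncomputable def expTilt (β : ℝ) (m : Measure ℝ) : Measure ℝ :=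
  m.withDensity fun z => ENNReal.ofReal (Real.exp (β * z))

section expTilt

variable {β : ℝ} {m : Measure ℝ}

lemma integrable_expTilt_iff {g : ℝ → ℝ} :
    Integrable g (expTilt β m) ↔ Integrable (fun z => Real.exp (β * z) * g z) m := by
  rw [expTilt, integrable_withDensity_iff_integrable_smul' (by fun_prop)
    (ae_of_all _ fun z => ENNReal.ofReal_lt_top)]
  simp only [ENNReal.toReal_ofReal (Real.exp_pos _).le, smul_eq_mul]

lemma integral_expTilt (β : ℝ) (m : Measure ℝ) (g : ℝ → ℝ) :
    ∫ z, g z ∂expTilt β m = ∫ z, Real.exp (β * z) * g z ∂m := by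
  rw [expTilt, integral_withDensity_eq_integral_toReal_smul (by fun_prop)
    (ae_of_all _ fun z => ENNReal.ofReal_lt_top)]
  simp only [ENNReal.toReal_ofReal (Real.exp_pos _).le, smul_eq_mul]

lemma expTilt_ne_zero (hm : m ≠ 0) : expTilt β m ≠ 0 := by
  have hac : m ≪ expTilt β m :=
    withDensity_absolutelyContinuous' (by fun_prop) (ae_of_all _ fun z => by
      simpa using Real.exp_pos (β * z))
  exact fun h => hm (Measure.absolutelyContinuous_zero_iff.1 (h ▸ hac))

lemma expTilt_Ici (hm : m (Ici 0) = 0) : expTilt β m (Ici 0) = 0 :=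
  withDensity_absolutelyContinuous _ _ hm

end expTilt

lemma integrable_of_abs_le_min_one_abs {m : Measure ℝ} (hm : m (Ici 0) = 0)
    (hmin : Integrable (fun z => min 1 |z|) m) {g : ℝ → ℝ} (hg : AEStronglyMeasurable g m) (C : ℝ)
    (h : ∀ z < 0, |g z| ≤ C * min 1 |z|) : Integrable g m :=
  (hmin.const_mul C).mono' hg ((ae_lt_of_measure_Ici_eq_zero hm).mono h)

namespace IsNegLevyMeasure

variable {ν ν₁ ν₂ : Measure ℝ}

lemma of_integrable_min_one_abs (hν0 : ν (Ici 0) = 0)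
    (hmin : Integrable (fun z => min 1 |z|) ν) : IsNegLevyMeasure ν := by
  refine ⟨hν0, Integrable.lintegral_lt_top <|
    integrable_of_abs_le_min_one_abs hν0 hmin (by fun_prop) 1 fun z _ => ?_⟩
  rw [abs_of_nonneg (by positivity), one_mul]
  exact min_one_sq_le_min_one_abs z

lemma add (h₁ : IsNegLevyMeasure ν₁) (h₂ : IsNegLevyMeasure ν₂) : IsNegLevyMeasure (ν₁ + ν₂) :=
  ⟨by simp [h₁.carried, h₂.carried], by
    simpa only [lintegral_add_measure, ENNReal.add_lt_top] using ⟨h₁.integrates, h₂.integrates⟩⟩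

lemma smul (h : IsNegLevyMeasure ν) {c : ENNReal} (hc : c ≠ ⊤) : IsNegLevyMeasure (c • ν) :=
  ⟨by simp [h.carried], by
    simpa only [lintegral_smul_measure, smul_eq_mul] using
      ENNReal.mul_lt_top hc.lt_top h.integrates⟩

protected lemma expTilt (hν : IsNegLevyMeasure ν) {β : ℝ} (hβ : 0 ≤ β) :
    IsNegLevyMeasure (expTilt β ν) := by
  refine ⟨expTilt_Ici hν.carried, Integrable.lintegral_lt_top (integrable_expTilt_iff.2 ?_)⟩
  refine hν.integrable_of_abs_le (by fun_prop) 1 fun z hz => ?_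
  rw [abs_of_nonneg (by positivity)]
  gcongr
  exact exp_mul_le_one hβ hz.le

lemma integrable_exp_sub_one_mul_smallJump (hν : IsNegLevyMeasure ν) {β : ℝ} (hβ : 0 ≤ β) :
    Integrable (fun z => (Real.exp (β * z) - 1) * smallJump z) ν := by
  refine hν.integrable_of_abs_le (by fun_prop) (β + 1) fun z hz => ?_
  rcases lt_or_ge (-1) z with h | h
  · have habs : |z| ≤ 1 := abs_le.2 ⟨h.le, by linarith⟩
    have hexp := abs_exp_mul_sub_one_le hβ hz.le
    rw [min_eq_right habs] at hexp
    rw [abs_mul, smallJump_of_mem ⟨h, hz⟩, min_one_sq_of_mem ⟨h, hz⟩, ← sq_abs z, sq, ← mul_assoc]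
    gcongr
  · rw [smallJump_of_le h, mul_zero, abs_zero]
    positivity

end IsNegLevyMeasure

lemma levyKhintchine_add {μ₁ μ₂ σ : ℝ} {ν₁ ν₂ : Measure ℝ} (h₁ : IsNegLevyMeasure ν₁)
    (h₂ : IsNegLevyMeasure ν₂) {u : ℝ} (hu : 0 ≤ u) :
    levyKhintchine (μ₁ + μ₂) σ (ν₁ + ν₂) u =
      levyKhintchine μ₁ σ ν₁ u + levyKhintchine μ₂ 0 ν₂ u := by
  simp only [levyKhintchine_eq]
  rw [integral_add_measure (h₁.integrable_mul_compensatedPrimitive hu)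
    (h₂.integrable_mul_compensatedPrimitive hu)]
  ring

lemma levyKhintchine_smul {c : ℝ} (hc : 0 ≤ c) (μ : ℝ) (ν : Measure ℝ) (u : ℝ) :
    levyKhintchine (c * μ) 0 (ENNReal.ofReal c • ν) u = c * levyKhintchine μ 0 ν u := by
  simp only [levyKhintchine_eq]
  rw [integral_smul_measure, ENNReal.toReal_ofReal hc, smul_eq_mul]
  ring

lemma levyKhintchine_of_integrable_min_one_abs {κ : Measure ℝ} (hκ : κ (Ici 0) = 0)
    (hmin : Integrable (fun z => min 1 |z|) κ) (μ σ : ℝ) {u : ℝ} (hu : 0 ≤ u) :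
    levyKhintchine μ σ κ u = -(μ + ∫ z, smallJump z ∂κ) * u + σ ^ 2 / 2 * u ^ 2 +
      ∫ z, (Real.exp (u * z) - 1) ∂κ := by
  have hexp : Integrable (fun z => Real.exp (u * z) - 1) κ :=
    integrable_of_abs_le_min_one_abs hκ hmin (by fun_prop) _
      fun z hz => abs_exp_mul_sub_one_le hu hz.le
  have hjump : Integrable smallJump κ :=
    integrable_of_abs_le_min_one_abs hκ hmin (by fun_prop) 1
      fun z _ => (one_mul (min 1 |z|)).symm ▸ abs_smallJump_le z
  simp only [levyKhintchine, mul_assoc, mul_indicator_one_eq_smallJump]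
  rw [integral_sub hexp (hjump.const_mul u), integral_const_mul]
  ring

lemma levyKhintchine_expTilt {ν : Measure ℝ} (hν : IsNegLevyMeasure ν) (μ σ : ℝ) {β u : ℝ}
    (hβ : 0 ≤ β) (hu : 0 ≤ u) :
    levyKhintchine (μ - σ ^ 2 * β - ∫ z, (Real.exp (β * z) - 1) * smallJump z ∂ν) σ
        (expTilt β ν) u =
      levyKhintchine μ σ ν (u + β) - levyKhintchine μ σ ν β := by
  have hintegrand : ∀ z, Real.exp (β * z) * (u * compensatedPrimitive u z) =
      (u + β) * compensatedPrimitive (u + β) z - β * compensatedPrimitive β z +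
        u * ((Real.exp (β * z) - 1) * smallJump z) := fun z => by
    have hadd : Real.exp ((u + β) * z) = Real.exp (u * z) * Real.exp (β * z) := by
      rw [add_mul, Real.exp_add]
    unfold compensatedPrimitive
    linear_combination Real.exp (β * z) * mul_expPrimitive u z - mul_expPrimitive (u + β) z +
      mul_expPrimitive β z + hadd
  have hint₁ := hν.integrable_mul_compensatedPrimitive (add_nonneg hu hβ)
  have hint₂ := hν.integrable_mul_compensatedPrimitive hβ
  have hint₁₂ : Integrable (fun x => (u + β) * compensatedPrimitive (u + β) x -
      β * compensatedPrimitive β x) ν := hint₁.sub hint₂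
  have hint₃ := (hν.integrable_exp_sub_one_mul_smallJump hβ).const_mul u
  simp only [levyKhintchine_eq, integral_expTilt, hintegrand]
  rw [integral_add hint₁₂ hint₃, integral_sub hint₁ hint₂,
    integral_const_mul u]
  ring

/-- The measure `ν((-∞, z)) dz` on `(-∞, 0)`, with the mass of `ν` at `x` spread over `(x, 0)`. -/
noncomputable def tailMeasure (ν : Measure ℝ) : Measure ℝ :=
  ((ν.prod volume).restrict {p : ℝ × ℝ | p.1 < p.2 ∧ p.2 < 0}).map Prod.snd

lemma measurableSet_lt_and_lt_zero : MeasurableSet {p : ℝ × ℝ | p.1 < p.2 ∧ p.2 < 0} :=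
  (measurableSet_lt measurable_fst measurable_snd).inter
    (measurableSet_lt measurable_snd measurable_const)

lemma tailMeasure_Ici (ν : Measure ℝ) : tailMeasure ν (Ici 0) = 0 := by
  have hempty : Prod.snd ⁻¹' Ici 0 ∩ {p : ℝ × ℝ | p.1 < p.2 ∧ p.2 < 0} = ∅ :=
    eq_empty_of_forall_notMem fun _ h => (not_lt_of_ge h.1) h.2.2
  rw [tailMeasure, Measure.map_apply measurable_snd measurableSet_Ici,
    Measure.restrict_apply (measurable_snd measurableSet_Ici), hempty, measure_empty]

lemma lintegral_tailMeasure (ν : Measure ℝ) {g : ℝ → ENNReal} (hg : Measurable g) :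
    ∫⁻ z, g z ∂tailMeasure ν = ∫⁻ x, (∫⁻ z in Ioo x 0, g z) ∂ν := by
  rw [tailMeasure, lintegral_map hg measurable_snd,
    ← lintegral_indicator measurableSet_lt_and_lt_zero,
    lintegral_prod _ (Measurable.aemeasurable (by fun_prop (disch := measurability)))]
  simp only [← lintegral_indicator measurableSet_Ioo]
  rfl

lemma integral_tailMeasure (ν : Measure ℝ) [SFinite ν] {g : ℝ → ℝ} (hg : Measurable g)
    (hint : Integrable g (tailMeasure ν)) :
    ∫ z, g z ∂tailMeasure ν = ∫ x, (∫ z in Ioo x 0, g z) ∂ν := by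
  have hprod : Integrable ({p : ℝ × ℝ | p.1 < p.2 ∧ p.2 < 0}.indicator fun p => g p.2)
      (ν.prod volume) := by
    rw [integrable_indicator_iff measurableSet_lt_and_lt_zero]
    exact (integrable_map_measure hg.aestronglyMeasurable measurable_snd.aemeasurable).1 hint
  rw [tailMeasure, integral_map measurable_snd.aemeasurable hg.aestronglyMeasurable,
    ← integral_indicator measurableSet_lt_and_lt_zero, integral_prod _ hprod]
  simp only [← integral_indicator measurableSet_Ioo]
  rfl

lemma setIntegral_Ioo_eq_intervalIntegral {a b : ℝ} (hab : a ≤ b) (g : ℝ → ℝ) :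
    ∫ z in Ioo a b, g z = ∫ z in a..b, g z := by
  rw [intervalIntegral.integral_of_le hab, integral_Ioc_eq_integral_Ioo]

lemma intervalIntegrable_exp_mul_min_one_abs (β a b : ℝ) :
    IntervalIntegrable (fun z : ℝ => Real.exp (β * z) * min 1 |z|) volume a b :=
  Continuous.intervalIntegrable (by fun_prop) a b

lemma integral_exp_mul_min_one_abs_le_sq {β x : ℝ} (hβ : 0 ≤ β) (hx : x ≤ 0) :
    ∫ z in x..0, Real.exp (β * z) * min 1 |z| ≤ x ^ 2 := by
  calc ∫ z in x..0, Real.exp (β * z) * min 1 |z| ≤ ∫ z in x..0, -z := by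
        refine intervalIntegral.integral_mono_on hx (intervalIntegrable_exp_mul_min_one_abs _ _ _)
          (Continuous.intervalIntegrable (by fun_prop) _ _) fun z hz => ?_
        exact (mul_le_of_le_one_left (by positivity) (exp_mul_le_one hβ hz.2)).trans
          ((min_le_right _ _).trans_eq (abs_of_nonpos hz.2))
    _ = x ^ 2 / 2 := by
        rw [intervalIntegral.integral_neg, integral_id]
        ring
    _ ≤ x ^ 2 := half_le_self (sq_nonneg x)

lemma integral_exp_mul_min_one_abs_le_expPrimitive (β : ℝ) {x : ℝ} (hx : x ≤ 0) :
    ∫ z in x..0, Real.exp (β * z) * min 1 |z| ≤ expPrimitive β x :=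
  intervalIntegral.integral_mono_on hx (intervalIntegrable_exp_mul_min_one_abs _ _ _)
    (intervalIntegrable_exp_mul _ _ _)
    fun _ _ => mul_le_of_le_one_right (Real.exp_pos _).le (min_le_left _ _)

lemma integral_exp_mul_min_one_abs_le {β x : ℝ} (hβ : 0 ≤ β) (hx : x < 0) :
    ∫ z in x..0, Real.exp (β * z) * min 1 |z| ≤ min 1 (x ^ 2) + |compensatedPrimitive β x| := by
  rcases lt_or_ge (-1) x with h | h
  · rw [min_one_sq_of_mem ⟨h, hx⟩]
    exact (integral_exp_mul_min_one_abs_le_sq hβ hx.le).trans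
      (le_add_of_nonneg_right (abs_nonneg _))
  · rw [compensatedPrimitive_of_le h, abs_of_nonneg (expPrimitive_nonneg β hx.le)]
    exact (integral_exp_mul_min_one_abs_le_expPrimitive β hx.le).trans
      (le_add_of_nonneg_left (by positivity))

lemma integral_exp_mul_mul_exp_sub_one (β u x : ℝ) :
    ∫ z in x..0, Real.exp (β * z) * (Real.exp (u * z) - 1) =
      expPrimitive (u + β) x - expPrimitive β x := by
  rw [expPrimitive, expPrimitive, ← intervalIntegral.integral_sub
    (intervalIntegrable_exp_mul _ _ _) (intervalIntegrable_exp_mul _ _ _)]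
  refine intervalIntegral.integral_congr fun z _ => ?_
  simp only [add_mul, Real.exp_add]
  ring

namespace IsNegLevyMeasure

variable {ν : Measure ℝ} (hν : IsNegLevyMeasure ν)
include hν

lemma integrable_min_one_abs_expTilt_tailMeasure {β : ℝ} (hβ : 0 ≤ β)
    (hint : Integrable (compensatedPrimitive β) ν) :
    Integrable (fun z => min 1 |z|) (expTilt β (tailMeasure ν)) := by
  have hnonneg : ∀ z : ℝ, 0 ≤ Real.exp (β * z) * min 1 |z| := fun z => by positivity
  refine integrable_expTilt_iff.2 ⟨by fun_prop, ?_⟩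
  rw [hasFiniteIntegral_iff_ofReal (ae_of_all _ hnonneg), lintegral_tailMeasure ν (by fun_prop)]
  refine (lintegral_mono_ae ?_).trans_lt (hν.integrable_min_one_sq.add hint.abs).lintegral_lt_top
  filter_upwards [hν.ae_neg] with x hx
  have hx_int : IntegrableOn (fun z => Real.exp (β * z) * min 1 |z|) (Ioo x 0) :=
    (Continuous.integrableOn_Icc (by fun_prop)).mono_set Ioo_subset_Icc_self
  rw [← ofReal_integral_eq_lintegral_ofReal hx_int (ae_of_all _ hnonneg),
    setIntegral_Ioo_eq_intervalIntegral hx.le]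
  exact ENNReal.ofReal_le_ofReal (integral_exp_mul_min_one_abs_le hβ hx)

-- Integration by parts: the tail measure turns `exp (u z) - 1` into slopes of the exponent.
lemma integral_exp_sub_one_expTilt_tailMeasure {β u : ℝ}
    (hintβ : Integrable (compensatedPrimitive β) ν)
    (hintu : Integrable (compensatedPrimitive (u + β)) ν)
    (hint : Integrable (fun z => Real.exp (u * z) - 1) (expTilt β (tailMeasure ν))) :
    ∫ z, (Real.exp (u * z) - 1) ∂expTilt β (tailMeasure ν) =
      (∫ x, compensatedPrimitive (u + β) x ∂ν) - ∫ x, compensatedPrimitive β x ∂ν := by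
  have := hν.sFinite
  rw [integral_expTilt, integral_tailMeasure ν (by fun_prop) (integrable_expTilt_iff.1 hint),
    ← integral_sub hintu hintβ]
  refine integral_congr_ae ?_
  filter_upwards [hν.ae_neg] with x hx
  rw [setIntegral_Ioo_eq_intervalIntegral hx.le, integral_exp_mul_mul_exp_sub_one,
    compensatedPrimitive, compensatedPrimitive, add_sub_add_right_eq_sub]

end IsNegLevyMeasure

lemma integral_exp_mul_Iio {s : ℝ} (hs : 0 < s) :
    ∫ z in Iio (0 : ℝ), Real.exp (s * z) = s⁻¹ := by
  rw [← integral_Iic_eq_integral_Iio, integral_exp_mul_Iic hs, mul_zero, Real.exp_zero, one_div]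

lemma integrableOn_exp_mul_Iio {s : ℝ} (hs : 0 < s) :
    IntegrableOn (fun z => Real.exp (s * z)) (Iio 0) :=
  (integrableOn_exp_mul_Iic hs 0).mono_set Iio_subset_Iic_self

lemma integrable_min_one_abs_expTilt_Iio {β : ℝ} (hβ : 0 < β) :
    Integrable (fun z => min 1 |z|) (expTilt β (volume.restrict (Iio 0))) := by
  refine integrable_expTilt_iff.2 <| (integrableOn_exp_mul_Iio hβ).mono' (by fun_prop)
    (ae_of_all _ fun z => ?_)
  rw [Real.norm_of_nonneg (by positivity)]
  exact mul_le_of_le_one_right (Real.exp_pos _).le (min_le_left _ _)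

lemma integral_exp_sub_one_expTilt_Iio {β u : ℝ} (hβ : 0 < β) (huβ : 0 < u + β) :
    ∫ z, (Real.exp (u * z) - 1) ∂expTilt β (volume.restrict (Iio 0)) = (u + β)⁻¹ - β⁻¹ := by
  have hintegrand : ∀ z, Real.exp (β * z) * (Real.exp (u * z) - 1) =
      Real.exp ((u + β) * z) - Real.exp (β * z) := fun z => by
    rw [add_mul, Real.exp_add]
    ring
  simp only [integral_expTilt, hintegrand]
  rw [integral_sub (integrableOn_exp_mul_Iio huβ) (integrableOn_exp_mul_Iio hβ),
    integral_exp_mul_Iio huβ, integral_exp_mul_Iio hβ]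

/-- The tail measure of `ν` enlarged by a mass `q` at `-∞`, which stands for killing at rate `q`. -/
noncomputable def killedTailMeasure (ν : Measure ℝ) (q : ℝ) : Measure ℝ :=
  tailMeasure ν + ENNReal.ofReal q • volume.restrict (Iio 0)

lemma killedTailMeasure_Ici (ν : Measure ℝ) (q : ℝ) : killedTailMeasure ν q (Ici 0) = 0 := by
  simp [killedTailMeasure, tailMeasure_Ici, Measure.restrict_apply measurableSet_Ici,
    Ici_inter_Iio]

lemma expTilt_killedTailMeasure (β : ℝ) (ν : Measure ℝ) (q : ℝ) :
    expTilt β (killedTailMeasure ν q) = expTilt β (tailMeasure ν) +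
      ENNReal.ofReal q • expTilt β (volume.restrict (Iio 0)) := by
  rw [expTilt, killedTailMeasure, withDensity_add_measure, withDensity_smul_measure]
  rfl

namespace IsNegLevyMeasure

variable {ν : Measure ℝ} (hν : IsNegLevyMeasure ν)
include hν

lemma integrable_min_one_abs_expTilt_killedTailMeasure {β q : ℝ} (hβ : 0 ≤ β)
    (hq0 : β = 0 → q = 0) (hint : Integrable (compensatedPrimitive β) ν) :
    Integrable (fun z => min 1 |z|) (expTilt β (killedTailMeasure ν q)) := by
  rw [expTilt_killedTailMeasure]
  refine (hν.integrable_min_one_abs_expTilt_tailMeasure hβ hint).add_measure ?_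
  rcases hβ.eq_or_lt with rfl | hβ
  · simp [hq0 rfl]
  · exact (integrable_min_one_abs_expTilt_Iio hβ).smul_measure ENNReal.ofReal_ne_top

lemma isNegLevyMeasure_expTilt_killedTailMeasure {β q : ℝ} (hβ : 0 ≤ β) (hq0 : β = 0 → q = 0)
    (hint : Integrable (compensatedPrimitive β) ν) :
    IsNegLevyMeasure (expTilt β (killedTailMeasure ν q)) :=
  .of_integrable_min_one_abs (expTilt_Ici (killedTailMeasure_Ici ν q))
    (hν.integrable_min_one_abs_expTilt_killedTailMeasure hβ hq0 hint)

lemma integral_exp_sub_one_expTilt_killedTailMeasure {β q u : ℝ} (hβ : 0 ≤ β) (hu : 0 < u)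
    (hq : 0 ≤ q) (hq0 : β = 0 → q = 0) (hint : Integrable (compensatedPrimitive β) ν) :
    ∫ z, (Real.exp (u * z) - 1) ∂expTilt β (killedTailMeasure ν q) =
      (∫ x, compensatedPrimitive (u + β) x ∂ν) - (∫ x, compensatedPrimitive β x ∂ν) +
        q * ((u + β)⁻¹ - β⁻¹) := by
  have hsum : Integrable (fun z => Real.exp (u * z) - 1) (expTilt β (killedTailMeasure ν q)) :=
    integrable_of_abs_le_min_one_abs (expTilt_Ici (killedTailMeasure_Ici ν q))
      (hν.integrable_min_one_abs_expTilt_killedTailMeasure hβ hq0 hint) (by fun_prop) _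
      fun z hz => abs_exp_mul_sub_one_le hu.le hz.le
  rw [expTilt_killedTailMeasure] at hsum ⊢
  rw [integral_add_measure hsum.left_of_add_measure hsum.right_of_add_measure,
    hν.integral_exp_sub_one_expTilt_tailMeasure hint
      (hν.integrable_compensatedPrimitive (add_pos_of_pos_of_nonneg hu hβ))
      hsum.left_of_add_measure,
    integral_smul_measure, ENNReal.toReal_ofReal hq, smul_eq_mul]
  rcases hβ.eq_or_lt with rfl | hβ
  · simp [hq0 rfl]
  · rw [integral_exp_sub_one_expTilt_Iio hβ (add_pos hu hβ)]

lemma levyKhintchine_expTilt_killedTailMeasure (μ σ : ℝ) {β q u : ℝ} (hβ : 0 ≤ β) (hu : 0 < u)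
    (hq : 0 ≤ q) (hq0 : β = 0 → q = 0) (hint : Integrable (compensatedPrimitive β) ν) :
    levyKhintchine (σ ^ 2 / 2 - ∫ z, smallJump z ∂expTilt β (killedTailMeasure ν q)) 0
        (expTilt β (killedTailMeasure ν q)) u =
      levySlope μ σ ν β - levySlope μ σ ν (u + β) + q * ((u + β)⁻¹ - β⁻¹) := by
  rw [levyKhintchine_of_integrable_min_one_abs (expTilt_Ici (killedTailMeasure_Ici ν q))
      (hν.integrable_min_one_abs_expTilt_killedTailMeasure hβ hq0 hint) _ _ hu.le,
    hν.integral_exp_sub_one_expTilt_killedTailMeasure hβ hu hq hq0 hint, levySlope, levySlope]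
  ring

end IsNegLevyMeasure

lemma tendsto_expTransform_atTop {f : ℝ → ℝ} (hf : Tendsto f atTop atTop) (δ β : ℝ) :
    Tendsto (expTransform δ β f) atTop atTop := by
  have hshift : Tendsto (fun u : ℝ => u + β) atTop atTop :=
    tendsto_atTop_add_const_right _ β tendsto_id
  have hfactor : Tendsto (fun u : ℝ => (u + β - δ) / (u + β)) atTop (𝓝 1) := by
    have hlim : Tendsto (fun u : ℝ => 1 - δ / (u + β)) atTop (𝓝 1) := by
      simpa only [sub_zero] using (hshift.const_div_atTop δ).const_sub 1
    refine hlim.congr' ?_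
    filter_upwards [hshift.eventually_gt_atTop 0] with u hu
    rw [sub_div, div_self hu.ne']
  exact tendsto_atTop_add_const_right _ _ (hfactor.pos_mul_atTop one_pos (hf.comp hshift))

lemma expTransform_zero (δ β : ℝ) (f : ℝ → ℝ) : expTransform δ β f 0 = 0 := by
  simp [expTransform]

lemma expTransform_eq_sub_sub (δ : ℝ) {β u : ℝ} {f : ℝ → ℝ} (hu : u + β ≠ 0)
    (h0 : β = 0 → f β = 0) :
    expTransform δ β f u = f (u + β) - f β - δ * (f (u + β) / (u + β) - f β / β) := by
  rw [expTransform, sub_div, div_self hu]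
  rcases eq_or_ne β 0 with rfl | hβ
  · rw [h0 rfl]
    ring
  · rw [sub_div, div_self hβ]
    ring

section

variable {ψ : ℝ → ℝ} {μ σ : ℝ} {ν : Measure ℝ} {q δ β : ℝ}

-- For `t = 0` both sides vanish, by the conventions `x / 0 = 0` and `0⁻¹ = 0`.
lemma killedExponent_div_eq {t : ℝ} (hψt : ψ t = levyKhintchine μ σ ν t)
    (h0 : t = 0 → levySlope μ σ ν t = 0) :
    killedExponent ψ q t / t = levySlope μ σ ν t - q * t⁻¹ := by
  rw [killedExponent, hψt, levyKhintchine_eq_mul_levySlope]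
  rcases eq_or_ne t 0 with rfl | ht
  · simp [h0 rfl]
  · field_simp

lemma IsNegLevyMeasure.exists_expTransform_eq_levyKhintchine (hν : IsNegLevyMeasure ν)
    (hrep : ∀ t, 0 ≤ t → ψ t = levyKhintchine μ σ ν t) (hq : 0 ≤ q) (hδ : 0 ≤ δ) (hβ : 0 ≤ β)
    (hq0 : β = 0 → q = 0) (hslope0 : β = 0 → levySlope μ σ ν β = 0)
    (hint : Integrable (compensatedPrimitive β) ν) :
    ∃ μ', ∀ u, 0 ≤ u → expTransform δ β (killedExponent ψ q) u =
      levyKhintchine μ' σ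
        (expTilt β ν + ENNReal.ofReal δ • expTilt β (killedTailMeasure ν q)) u := by
  have hκ := hν.isNegLevyMeasure_expTilt_killedTailMeasure hβ hq0 hint
  refine ⟨μ - σ ^ 2 * β - (∫ z, (Real.exp (β * z) - 1) * smallJump z ∂ν) +
    δ * (σ ^ 2 / 2 - ∫ z, smallJump z ∂expTilt β (killedTailMeasure ν q)), fun u hu => ?_⟩
  rcases hu.eq_or_lt with rfl | hu
  · rw [expTransform_zero, levyKhintchine_zero]
  have huβ : 0 < u + β := add_pos_of_pos_of_nonneg hu hβ
  have hkilled0 : β = 0 → killedExponent ψ q β = 0 := fun h => by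
    rw [killedExponent, hrep β hβ, hq0 h, h, levyKhintchine_zero, sub_zero]
  rw [levyKhintchine_add (hν.expTilt hβ) (hκ.smul ENNReal.ofReal_ne_top) hu.le,
    levyKhintchine_expTilt hν μ σ hβ hu.le, levyKhintchine_smul hδ,
    hν.levyKhintchine_expTilt_killedTailMeasure μ σ hβ hu hq hq0 hint,
    expTransform_eq_sub_sub δ huβ.ne' hkilled0,
    killedExponent_div_eq (hrep _ huβ.le) fun h => absurd h huβ.ne',
    killedExponent_div_eq (hrep β hβ) hslope0, killedExponent, killedExponent,
    hrep _ huβ.le, hrep β hβ]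
  ring

lemma IsLaplaceExponent.isLaplaceExponent_expTransform (hψ : IsLaplaceExponent ψ)
    (hq : 0 ≤ q) (hδ : 0 ≤ δ) (hβ : 0 ≤ β) (h0 : β = 0 → HasRightDerivAtZero ψ 0 ∧ q = 0) :
    IsLaplaceExponent (expTransform δ β (killedExponent ψ q)) := by
  have hlim : Tendsto (expTransform δ β (killedExponent ψ q)) atTop atTop :=
    tendsto_expTransform_atTop (tendsto_atTop_add_const_right _ (-q) hψ.tendsto_atTop) δ β
  obtain ⟨μ, σ, ν, hT, hrep⟩ := hψ
  have hν := hT.isNegLevyMeasure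
  obtain ⟨hint, hslope0⟩ : Integrable (compensatedPrimitive β) ν ∧
      (β = 0 → levySlope μ σ ν β = 0) := by
    rcases hβ.eq_or_lt with rfl | hβ
    · obtain ⟨hint, hslope⟩ := hν.levySlope_zero_of_hasRightDerivAtZero hrep (h0 rfl).1
      exact ⟨hint, fun _ => hslope⟩
    · exact ⟨hν.integrable_compensatedPrimitive hβ, fun h => absurd h hβ.ne'⟩
  have hq0 : β = 0 → q = 0 := fun h => (h0 h).2
  obtain ⟨μ', heq⟩ := hν.exists_expTransform_eq_levyKhintchine hrep hq hδ hβ hq0 hslope0 hint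
  have hκ := hν.isNegLevyMeasure_expTilt_killedTailMeasure hβ hq0 hint
  have hLévy := (hν.expTilt hβ).add (hκ.smul (ENNReal.ofReal_ne_top (r := δ)))
  exact ⟨μ', σ, _, hLévy.isSpectrallyNegativeTriplet_of_tendsto
    (hT.ne_zero_or_ne_zero.imp_right fun hne h =>
      expTilt_ne_zero hne (le_bot_iff.1 ((Measure.le_add_right le_rfl).trans_eq h)))
    (hlim.congr' ((eventually_ge_atTop 0).mono heq)), heq⟩

end

open ProbabilityTheory in
-- Both complex moment generating functions are analytic on a common vertical strip around the
-- imaginary axis, where they restrict to the characteristic functions.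
lemma ext_of_mgf_eventuallyEq_zero {P P' : Measure ℝ} [IsFiniteMeasure P] [IsFiniteMeasure P']
    (hP : 0 ∈ interior (integrableExpSet id P)) (hP' : 0 ∈ interior (integrableExpSet id P'))
    (h : mgf id P =ᶠ[𝓝 0] mgf id P') : P = P' := by
  set I := interior (integrableExpSet id P) ∩ interior (integrableExpSet id P') with hI
  have hstrip : EqOn (complexMGF id P) (complexMGF id P') {z | z.re ∈ I} := by
    refine AnalyticOnNhd.eqOn_of_preconnected_of_frequently_eq (z₀ := 0)
      (analyticOnNhd_complexMGF.mono fun z hz => hz.1)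
      (analyticOnNhd_complexMGF.mono fun z hz => hz.2)
      ((convex_integrableExpSet.interior.inter convex_integrableExpSet.interior).linear_preimage
        Complex.reLm).isPreconnected ⟨hP, hP'⟩ ?_
    have hreal : Tendsto (fun x : ℝ => (x : ℂ)) (𝓝[≠] 0) (𝓝[≠] 0) :=
      tendsto_nhdsWithin_iff.2
        ⟨(Complex.continuous_ofReal.tendsto' 0 0 Complex.ofReal_zero).mono_left nhdsWithin_le_nhds,
          eventually_mem_nhdsWithin.mono fun x hx => by simpa using hx⟩
    refine hreal.frequently (Eventually.frequently ?_)
    filter_upwards [h.filter_mono nhdsWithin_le_nhds] with x hx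
    rw [complexMGF_ofReal, complexMGF_ofReal, hx]
  refine Measure.ext_of_charFun (funext fun t => ?_)
  rw [← complexMGF_id_mul_I, ← complexMGF_id_mul_I]
  exact hstrip (by simpa [hI] using ⟨hP, hP'⟩)

/-- The measure `exp (-t x) U(x) dx` on `(0, ∞)`; a Laplace transform of `U` becomes a moment
generating function of it. -/
noncomputable def laplaceMeasure (t : ℝ) (U : ℝ → ℝ) : Measure ℝ :=
  (volume.restrict (Ioi 0)).withDensity fun x => ENNReal.ofReal (Real.exp (-t * x) * U x)

section laplaceMeasure

variable {U : ℝ → ℝ} {s t : ℝ}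

lemma isFiniteMeasure_laplaceMeasure
    (h : IntegrableOn (fun x => Real.exp (-t * x) * U x) (Ioi 0)) :
    IsFiniteMeasure (laplaceMeasure t U) :=
  isFiniteMeasure_withDensity (Integrable.lintegral_lt_top h).ne

lemma toReal_density_mul_exp (hU : ∀ x, 0 ≤ U x) (s t x : ℝ) :
    (ENNReal.ofReal (Real.exp (-t * x) * U x)).toReal • Real.exp (s * x) =
      Real.exp (-(t - s) * x) * U x := by
  rw [ENNReal.toReal_ofReal (mul_nonneg (Real.exp_pos _).le (hU x)), smul_eq_mul, mul_right_comm,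
    ← Real.exp_add]
  ring_nf

lemma mem_integrableExpSet_laplaceMeasure_iff (hU : ∀ x, 0 ≤ U x)
    (h : IntegrableOn (fun x => Real.exp (-t * x) * U x) (Ioi 0)) :
    s ∈ ProbabilityTheory.integrableExpSet id (laplaceMeasure t U) ↔
      IntegrableOn (fun x => Real.exp (-(t - s) * x) * U x) (Ioi 0) := by
  simp only [ProbabilityTheory.integrableExpSet, mem_ofPred_eq, id, laplaceMeasure]
  rw [integrable_withDensity_iff_integrable_smul₀' h.1.aemeasurable.ennreal_ofReal
    (ae_of_all _ fun x => ENNReal.ofReal_lt_top)]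
  simp only [toReal_density_mul_exp hU, IntegrableOn]

lemma mgf_laplaceMeasure (hU : ∀ x, 0 ≤ U x)
    (h : IntegrableOn (fun x => Real.exp (-t * x) * U x) (Ioi 0)) (s : ℝ) :
    ProbabilityTheory.mgf id (laplaceMeasure t U) s =
      ∫ x in Ioi (0 : ℝ), Real.exp (-(t - s) * x) * U x := by
  rw [ProbabilityTheory.mgf, laplaceMeasure,
    integral_withDensity_eq_integral_toReal_smul₀ h.1.aemeasurable.ennreal_ofReal
      (ae_of_all _ fun x => ENNReal.ofReal_lt_top)]
  simp only [id, toReal_density_mul_exp hU]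

lemma zero_mem_interior_integrableExpSet_laplaceMeasure {r : ℝ} (hU : ∀ x, 0 ≤ U x) (hrt : r < t)
    (h : ∀ s, r < s → IntegrableOn (fun x => Real.exp (-s * x) * U x) (Ioi 0)) :
    0 ∈ interior (ProbabilityTheory.integrableExpSet id (laplaceMeasure t U)) := by
  refine mem_interior_iff_mem_nhds.2 (mem_of_superset (Iio_mem_nhds (sub_pos.2 hrt)) fun s hs => ?_)
  exact (mem_integrableExpSet_laplaceMeasure_iff hU (h t hrt)).2 (h _ (lt_sub_comm.1 hs))

end laplaceMeasure

lemma ae_eq_of_laplace_eq {V W : ℝ → ℝ} (hV0 : ∀ x, 0 ≤ V x) (hW0 : ∀ x, 0 ≤ W x) {r : ℝ}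
    (hV : ∀ t, r < t → IntegrableOn (fun x => Real.exp (-t * x) * V x) (Ioi 0))
    (hW : ∀ t, r < t → IntegrableOn (fun x => Real.exp (-t * x) * W x) (Ioi 0))
    (h : ∀ t, r < t → ∫ x in Ioi (0 : ℝ), Real.exp (-t * x) * V x =
      ∫ x in Ioi (0 : ℝ), Real.exp (-t * x) * W x) :
    V =ᵐ[volume.restrict (Ioi 0)] W := by
  obtain ⟨t, ht⟩ := exists_gt r
  have := isFiniteMeasure_laplaceMeasure (hV t ht)
  have := isFiniteMeasure_laplaceMeasure (hW t ht)
  have hmeasure : laplaceMeasure t V = laplaceMeasure t W := by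
    refine ext_of_mgf_eventuallyEq_zero
      (zero_mem_interior_integrableExpSet_laplaceMeasure hV0 ht hV)
      (zero_mem_interior_integrableExpSet_laplaceMeasure hW0 ht hW) ?_
    filter_upwards [Iio_mem_nhds (sub_pos.2 ht)] with s hs
    rw [mgf_laplaceMeasure hV0 (hV t ht), mgf_laplaceMeasure hW0 (hW t ht),
      h _ (lt_sub_comm.1 hs)]
  rw [laplaceMeasure, laplaceMeasure, withDensity_eq_iff (hV t ht).1.aemeasurable.ennreal_ofReal
    (hW t ht).1.aemeasurable.ennreal_ofReal (Integrable.lintegral_lt_top (hV t ht)).ne] at hmeasure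
  filter_upwards [hmeasure] with x hx
  rw [ENNReal.ofReal_eq_ofReal_iff (mul_nonneg (Real.exp_pos _).le (hV0 x))
    (mul_nonneg (Real.exp_pos _).le (hW0 x))] at hx
  exact mul_left_cancel₀ (Real.exp_pos _).ne' hx

lemma eq_of_ae_eq_of_continuousWithinAt_Ici {E : Type*} [TopologicalSpace E] [T2Space E]
    {V W : ℝ → E} {a x : ℝ} (hx : a ≤ x) (h : V =ᵐ[volume.restrict (Ioi a)] W)
    (hV : ContinuousWithinAt V (Ici x) x) (hW : ContinuousWithinAt W (Ici x) x) : V x = W x := by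
  have hfreq : ∃ᶠ y in 𝓝[>] x, V y = W y := by
    intro hne
    obtain ⟨b, hxb, hsub⟩ := mem_nhdsGT_iff_exists_Ioo_subset.1 hne
    have hnull : volume (Ioo x b) = 0 := by
      rw [EventuallyEq, ae_restrict_iff' measurableSet_Ioi] at h
      refine measure_eq_zero_iff_ae_notMem.2 (h.mono fun y hVW hy => ?_)
      exact hsub hy (hVW (hx.trans_lt hy.1))
    rw [Real.volume_Ioo, ENNReal.ofReal_eq_zero, sub_nonpos] at hnull
    exact hnull.not_gt hxb
  exact tendsto_nhds_unique_of_frequently_eq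
    (hV.mono_left (nhdsWithin_mono x Ioi_subset_Ici_self))
    (hW.mono_left (nhdsWithin_mono x Ioi_subset_Ici_self)) hfreq

lemma IsScaleFunction.unique {ψ : ℝ → ℝ} {q : ℝ} {V W : ℝ → ℝ} (hV : IsScaleFunction ψ q V)
    (hW : IsScaleFunction ψ q W) : V = W := by
  have hae : V =ᵐ[volume.restrict (Ioi 0)] W :=
    ae_eq_of_laplace_eq hV.nonneg hW.nonneg hV.integrable hW.integrable
      fun t ht => by rw [hV.laplace t ht, hW.laplace t ht]
  funext x
  rcases lt_or_ge x 0 with hx | hx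
  · rw [hV.eq_zero x hx, hW.eq_zero x hx]
  · exact eq_of_ae_eq_of_continuousWithinAt_Ici hx hae (hV.right_continuous x hx)
      (hW.right_continuous x hx)

section Convolution

variable {W : ℝ → ℝ} {s δ : ℝ}

lemma integrableOn_exp_mul_Icc
    (hW : IntegrableOn (fun x => Real.exp (-s * x) * W x) (Ioi 0)) (δ b : ℝ) :
    IntegrableOn (fun y => Real.exp (-δ * y) * W y) (Icc 0 b) := by
  have hIcc : IntegrableOn (fun x => Real.exp (-s * x) * W x) (Icc 0 b) :=
    (integrableOn_Icc_iff_integrableOn_Ioc (by simp)).2 (hW.mono_set Ioc_subset_Ioi_self)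
  have hweight : ContinuousOn (fun x : ℝ => Real.exp ((s - δ) * x)) (Icc 0 b) := by fun_prop
  refine (hIcc.continuousOn_mul hweight isCompact_Icc).congr (ae_of_all _ fun y => ?_)
  simp only [← mul_assoc, ← Real.exp_add]
  ring_nf

lemma continuousWithinAt_integral_Ici {f : ℝ → ℝ} (hf : ∀ b, IntegrableOn f (Icc 0 b)) {x : ℝ}
    (hx : 0 ≤ x) : ContinuousWithinAt (fun x => ∫ y in (0 : ℝ)..x, f y) (Ici x) x := by
  have hcont : ContinuousOn (fun x => ∫ y in (0 : ℝ)..x, f y) (Icc 0 (x + 1)) := by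
    rw [← uIcc_of_le (by linarith)]
    exact intervalIntegral.continuousOn_primitive_interval
      (by simpa only [uIcc_of_le (by linarith : (0 : ℝ) ≤ x + 1)] using hf (x + 1))
  exact (hcont x ⟨hx, (lt_add_one x).le⟩).mono_of_mem_nhdsWithin
    (mem_of_superset (Icc_mem_nhdsGE (lt_add_one x)) (Icc_subset_Icc_left hx))

lemma integral_exp_mul_exp_sub (W : ℝ → ℝ) (s δ x : ℝ) :
    ∫ y in (0 : ℝ)..x, ContinuousLinearMap.mul ℝ ℝ
        (Real.exp (-(s + δ) * y) * W y) (Real.exp (-s * (x - y))) =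
      Real.exp (-s * x) * ∫ y in (0 : ℝ)..x, Real.exp (-δ * y) * W y := by
  rw [← intervalIntegral.integral_const_mul]
  refine intervalIntegral.integral_congr fun y _ => ?_
  simp only [ContinuousLinearMap.mul_apply']
  rw [mul_right_comm, ← Real.exp_add, ← mul_assoc, ← Real.exp_add]
  ring_nf

lemma integrableOn_exp_mul_integral (hs : 0 < s)
    (hW : IntegrableOn (fun x => Real.exp (-(s + δ) * x) * W x) (Ioi 0)) :
    IntegrableOn (fun x => Real.exp (-s * x) * ∫ y in (0 : ℝ)..x, Real.exp (-δ * y) * W y)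
      (Ioi 0) := by
  have hconv := integrable_posConvolution hW (integrableOn_exp_mul_Ioi (neg_lt_zero.2 hs) 0)
    (ContinuousLinearMap.mul ℝ ℝ)
  rw [posConvolution, integrable_indicator_iff measurableSet_Ioi] at hconv
  exact hconv.congr (ae_of_all _ (integral_exp_mul_exp_sub W s δ))

lemma integral_exp_mul_integral (hs : 0 < s)
    (hW : IntegrableOn (fun x => Real.exp (-(s + δ) * x) * W x) (Ioi 0)) :
    ∫ x in Ioi (0 : ℝ), Real.exp (-s * x) * (∫ y in (0 : ℝ)..x, Real.exp (-δ * y) * W y) =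
      (∫ x in Ioi (0 : ℝ), Real.exp (-(s + δ) * x) * W x) / s := by
  have hconv := integral_posConvolution hW (integrableOn_exp_mul_Ioi (neg_lt_zero.2 hs) 0)
    (ContinuousLinearMap.mul ℝ ℝ)
  simp only [integral_exp_mul_exp_sub, integral_exp_mul_Ioi (neg_lt_zero.2 hs)] at hconv
  rw [hconv, ContinuousLinearMap.mul_apply']
  simp [div_eq_mul_inv]

end Convolution

/-- The scale function of `expTransform δ β f` in terms of the scale function `W` of `f`, valid when
the constant term `(β - δ) / β * f β` of the transform vanishes. -/
noncomputable def transformedScale (δ β : ℝ) (W : ℝ → ℝ) (x : ℝ) : ℝ :=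
  Real.exp (-β * x) * (W x + δ * Real.exp (δ * x) * ∫ y in (0 : ℝ)..x, Real.exp (-δ * y) * W y)

lemma transformedScale_self (β : ℝ) (W : ℝ → ℝ) (x : ℝ) :
    transformedScale β β W x =
      Real.exp (-β * x) * W x + β * ∫ y in (0 : ℝ)..x, Real.exp (-β * y) * W y := by
  have hexp : Real.exp (-β * x) * Real.exp (β * x) = 1 := by
    rw [← Real.exp_add, neg_mul, neg_add_cancel, Real.exp_zero]
  rw [transformedScale]
  linear_combination (β * ∫ y in (0 : ℝ)..x, Real.exp (-β * y) * W y) * hexp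

lemma exp_mul_transformedScale (δ β t : ℝ) (W : ℝ → ℝ) (x : ℝ) :
    Real.exp (-t * x) * transformedScale δ β W x =
      Real.exp (-(t + β) * x) * W x + δ * (Real.exp (-(t + β - δ) * x) *
        ∫ y in (0 : ℝ)..x, Real.exp (-δ * y) * W y) := by
  have hfirst : Real.exp (-(t + β) * x) = Real.exp (-t * x) * Real.exp (-β * x) := by
    rw [← Real.exp_add]
    ring_nf
  have hsecond : Real.exp (-(t + β - δ) * x) = Real.exp (-(t + β) * x) * Real.exp (δ * x) := by
    rw [← Real.exp_add]
    ring_nf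
  rw [hsecond, hfirst, transformedScale]
  ring

lemma transformedScale_of_neg (δ β : ℝ) {W : ℝ → ℝ} (hW : ∀ x, x < 0 → W x = 0) {x : ℝ}
    (hx : x < 0) : transformedScale δ β W x = 0 := by
  have hint : ∫ y in (0 : ℝ)..x, Real.exp (-δ * y) * W y = 0 := by
    rw [intervalIntegral.integral_of_ge hx.le, integral_Ioc_eq_integral_Ioo,
      setIntegral_eq_zero_of_forall_eq_zero fun y hy => by rw [hW y hy.2, mul_zero], neg_zero]
  rw [transformedScale, hint, hW x hx, mul_zero, add_zero, mul_zero]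

lemma transformedScale_nonneg {δ : ℝ} (hδ : 0 ≤ δ) (β : ℝ) {W : ℝ → ℝ} (hW : ∀ x, 0 ≤ W x)
    {x : ℝ} (hx : 0 ≤ x) : 0 ≤ transformedScale δ β W x := by
  have hint : 0 ≤ ∫ y in (0 : ℝ)..x, Real.exp (-δ * y) * W y :=
    intervalIntegral.integral_nonneg hx fun y _ => mul_nonneg (Real.exp_pos _).le (hW y)
  have hWx := hW x
  unfold transformedScale
  positivity

section Laplace

variable {W : ℝ → ℝ} {δ β t : ℝ}

lemma integrableOn_exp_mul_transformedScale (hδ : δ < t + β)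
    (hW : IntegrableOn (fun x => Real.exp (-(t + β) * x) * W x) (Ioi 0)) :
    IntegrableOn (fun x => Real.exp (-t * x) * transformedScale δ β W x) (Ioi 0) := by
  simp only [exp_mul_transformedScale]
  exact hW.add ((integrableOn_exp_mul_integral (sub_pos.2 hδ)
    (by rwa [sub_add_cancel])).const_mul δ)

lemma integral_exp_mul_transformedScale (hδ : δ < t + β)
    (hW : IntegrableOn (fun x => Real.exp (-(t + β) * x) * W x) (Ioi 0)) :
    ∫ x in Ioi (0 : ℝ), Real.exp (-t * x) * transformedScale δ β W x =
      (t + β) / (t + β - δ) * ∫ x in Ioi (0 : ℝ), Real.exp (-(t + β) * x) * W x := by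
  have hs : 0 < t + β - δ := sub_pos.2 hδ
  have hW' : IntegrableOn (fun x => Real.exp (-(t + β - δ + δ) * x) * W x) (Ioi 0) := by
    rwa [sub_add_cancel]
  simp only [exp_mul_transformedScale]
  rw [integral_add hW ((integrableOn_exp_mul_integral hs hW').const_mul δ), integral_const_mul,
    integral_exp_mul_integral hs hW', sub_add_cancel]
  field_simp
  ring

end Laplace

section Exponent

variable {ψ W : ℝ → ℝ} {q δ β : ℝ} (hψ : IsLaplaceExponent ψ) (hq : 0 ≤ q)
  (hT : IsLaplaceExponent (expTransform δ β (killedExponent ψ q)))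
  (h0 : (β - δ) / β * killedExponent ψ q β = 0)
include hψ hq hT h0

-- Both `δ - β` and `largestRoot ψ q - β` are roots of the transformed exponent.
lemma lt_of_largestRoot_expTransform_lt {t : ℝ}
    (ht : largestRoot (expTransform δ β (killedExponent ψ q)) 0 < t) :
    δ < t + β ∧ largestRoot ψ q < t + β := by
  have hroot : ∀ s : ℝ, expTransform δ β (killedExponent ψ q) (s - β) = 0 → s < t + β := by
    intro s hs
    by_contra! hle
    have ht0 : 0 < t := (hT.le_largestRoot le_rfl (expTransform_zero _ _ _)).trans_lt ht
    have := hT.le_largestRoot (by linarith) hs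
    linarith
  refine ⟨hroot δ ?_, hroot _ ?_⟩
  · simp [expTransform, h0]
  · rw [expTransform, h0, sub_add_cancel, killedExponent, (hψ.largestRoot_mem hq).2, sub_self,
      mul_zero, sub_zero]

lemma isScaleFunction_transformedScale (hδ : 0 ≤ δ) (hW : IsScaleFunction ψ q W) :
    IsScaleFunction (expTransform δ β (killedExponent ψ q)) 0 (transformedScale δ β W) where
  nonneg x := by
    rcases lt_or_ge x 0 with hx | hx
    · exact (transformedScale_of_neg δ β hW.eq_zero hx).ge
    · exact transformedScale_nonneg hδ β hW.nonneg hx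
  eq_zero _ hx := transformedScale_of_neg δ β hW.eq_zero hx
  right_continuous x hx := by
    have hWx := hW.right_continuous x hx
    have hint := continuousWithinAt_integral_Ici
      (integrableOn_exp_mul_Icc (hW.integrable _ (lt_add_one _)) δ) hx
    unfold transformedScale
    fun_prop
  integrable t ht := by
    obtain ⟨htδ, htΦ⟩ := lt_of_largestRoot_expTransform_lt hψ hq hT h0 ht
    exact integrableOn_exp_mul_transformedScale htδ (hW.integrable _ htΦ)
  laplace t ht := by
    obtain ⟨htδ, htΦ⟩ := lt_of_largestRoot_expTransform_lt hψ hq hT h0 ht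
    rw [integral_exp_mul_transformedScale htδ (hW.integrable _ htΦ), hW.laplace _ htΦ,
      expTransform, h0, sub_zero, sub_zero, killedExponent, one_div, one_div, mul_inv, inv_div]

lemma isScaleFunction_expTransform_iff (hδ : 0 ≤ δ) (hW : IsScaleFunction ψ q W) (V : ℝ → ℝ) :
    IsScaleFunction (expTransform δ β (killedExponent ψ q)) 0 V ↔
      ∀ x, V x = transformedScale δ β W x := by
  have hscale := isScaleFunction_transformedScale hψ hq hT h0 hδ hW
  exact ⟨fun hV => congrFun (hV.unique hscale), fun hV => funext hV ▸ hscale⟩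

end Exponent

theorem mainTheorem11 (ψ : ℝ → ℝ) (hψ : IsLaplaceExponent ψ) (q : ℝ) (hq : 0 ≤ q)
    (W : ℝ → ℝ) (hW : IsScaleFunction ψ q W) :
    (∀ β : ℝ, 0 ≤ β → (β = 0 → HasRightDerivAtZero ψ 0 ∧ q = 0) →
      IsLaplaceExponent (expTransform β β (killedExponent ψ q)) ∧
      ∀ V : ℝ → ℝ, IsScaleFunction (expTransform β β (killedExponent ψ q)) 0 V ↔
        ∀ x : ℝ, V x = Real.exp (-β * x) * W x +
          β * ∫ y in (0 : ℝ)..x, Real.exp (-β * y) * W y) ∧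
    (∀ m : EReal, HasRightDerivAtZero ψ m → m ≤ 0 → ∀ δ : ℝ, 0 ≤ δ →
      IsLaplaceExponent (expTransform δ (largestRoot ψ q) (killedExponent ψ q)) ∧
      ∀ V : ℝ → ℝ,
        IsScaleFunction (expTransform δ (largestRoot ψ q) (killedExponent ψ q)) 0 V ↔
        ∀ x : ℝ, V x = Real.exp (-largestRoot ψ q * x) *
          (W x + δ * Real.exp (δ * x) * ∫ y in (0 : ℝ)..x, Real.exp (-δ * y) * W y)) := by
  refine ⟨fun β hβ h0 => ?_, fun m hm hm0 δ hδ => ?_⟩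
  · have hT := hψ.isLaplaceExponent_expTransform hq hβ hβ h0
    refine ⟨hT, fun V => ?_⟩
    simp only [← transformedScale_self]
    exact isScaleFunction_expTransform_iff hψ hq hT (by simp) hβ hW V
  · obtain ⟨hΦ, hΦq⟩ := hψ.largestRoot_mem hq
    have hT := hψ.isLaplaceExponent_expTransform hq hδ hΦ fun h => by
      obtain rfl : 0 = q := by rwa [h, hψ.map_zero] at hΦq
      exact ⟨hψ.hasRightDerivAtZero_zero_of_nonpos hm hm0 h, rfl⟩
    exact ⟨hT, isScaleFunction_expTransform_iff hψ hq hT (by simp [killedExponent, hΦq]) hδ hW⟩
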